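/- Let $\Lambda$ be an Artin algebra, that is, an algebra that is finitely generated as a module over a commutative artinian ring. Let $C$ be the center of $\Lambda$, let $E$ be the injective envelope of the $C$-module $C/J(C)$, where $J(C)$ is the Jacobson radical of $C$, and let $D=\operatorname{Hom}_C(-,E)$ be the standard duality from finitely generated left $\Lambda$-modules to finitely generated right $\Lambda$-modules. A module $M$ over a ring $R$ is called algebraically compact if every system of linear equations $\sum_{j\in J} a_{ij}X_j=m_i$ ($i\in I$), with a row-finite matrix $(a_{ij})$ over $R$ and $m_i\in M$, all of whose finite subsystems are solvable in $M$ is itself solvable in $M$; it is called $\Sigma$-algebraically compact if all direct sums of copies of $M$ are algebraically compact; and it is called endo-artinian (endo-noetherian) if it is artinian (noetherian) as a module over its endomorphism ring $\operatorname{End}_R(M)$. Let $(M_i)_{i\in I}$ be any family of finitely generated left $\Lambda$-modules. Then the following conditions are equivalent: (1) $\bigoplus_{i\in I}M_i$ is $\Sigma$-algebraically compact. (2) $\bigoplus_{i\in I}M_i$ is endo-artinian. (3) $\bigoplus_{i\in I}D(M_i)$ is endo-noetherian. -/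

import Mathlib

open scoped DirectSum

universe u v r u₁ v₁ w₁

section AlgebraicCompactness

variable (R : Type u) [Ring R] (M : Type v) [AddCommGroup M] [Module R M]

/-- A left `R`-module `M` is algebraically compact if every system of linear equations
`∑ j, a i j • X j = m i` (`i ∈ I`), with a row-finite coefficient matrix over `R` and constants
in `M`, that is finitely solvable in `M` is solvable in `M`. -/
def IsAlgebraicallyCompact : Prop :=
  ∀ (I J : Type (max u v)) (a : I → J →₀ R) (m : I → M),
    (∀ F : Finset I, ∃ x : J → M, ∀ i ∈ F, ((a i).sum fun j r => r • x j) = m i) →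
      ∃ x : J → M, ∀ i, ((a i).sum fun j r => r • x j) = m i

/-- `M` is `Σ`-algebraically compact if all direct sums of copies of `M` are algebraically
compact. -/
def IsSigmaAlgebraicallyCompact : Prop :=
  ∀ K : Type (max u v), IsAlgebraicallyCompact R (⨁ _ : K, M)

/-- `M` is endo-artinian if it is artinian as a module over its endomorphism ring. -/
def IsEndoArtinian : Prop :=
  IsArtinian (Module.End R M) M

/-- `M` is endo-noetherian if it is noetherian as a module over its endomorphism ring. -/
def IsEndoNoetherian : Prop :=
  IsNoetherian (Module.End R M) M

end AlgebraicCompactness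

/-- `ι : N → E` is an injective envelope of the module `N`: `E` is injective, and `ι` is an
embedding with essential image. -/
structure IsInjectiveEnvelope {C : Type u} [CommRing C] {N : Type v} [AddCommGroup N] [Module C N]
    {E : Type u} [AddCommGroup E] [Module C E] (ι : N →ₗ[C] E) : Prop where
  injective_module : Module.Injective C E
  injective_map : Function.Injective ι
  essential : ∀ U : Submodule C E, U ⊓ LinearMap.range ι = ⊥ → U = ⊥

section Dual

variable (Λ : Type u) [Ring Λ] (E : Type u) [AddCommGroup E] [Module (Subring.center Λ) E]
  (M : Type v) [AddCommGroup M] [Module Λ M]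

/-- The dual `D(M) = Hom_C(M, E)` of a left `Λ`-module `M`, where `C` is the center of `Λ`. -/
def CenterDual : Type (max u v) :=
  M →ₗ[Subring.center Λ] E

namespace CenterDual

instance : AddCommGroup (CenterDual Λ E M) :=
  inferInstanceAs (AddCommGroup (M →ₗ[Subring.center Λ] E))

instance : FunLike (CenterDual Λ E M) M E :=
  inferInstanceAs (FunLike (M →ₗ[Subring.center Λ] E) M E)

/-- Multiplication by `a : Λ` on a left `Λ`-module, as a map that is linear over the center. -/
def leftMul (a : Λ) : M →ₗ[Subring.center Λ] M where
  toFun m := a • m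
  map_add' := smul_add a
  map_smul' c m := by
    have h : a * (c : Λ) = c * a := (Subring.mem_center_iff.mp c.2 a)
    change a • ((c : Λ) • m) = (c : Λ) • (a • m)
    rw [← mul_smul, h, mul_smul]

/-- `D(M)` is a right `Λ`-module, that is, a left module over the opposite ring, through
`(φ a)(m) = φ (a m)`. -/
instance : Module Λᵐᵒᵖ (CenterDual Λ E M) where
  smul a φ := LinearMap.comp (show M →ₗ[Subring.center Λ] E from φ) (leftMul Λ M a.unop)
  one_smul φ := LinearMap.ext fun m => congrArg φ (one_smul Λ m)
  mul_smul a b φ := LinearMap.ext fun m => congrArg φ (mul_smul b.unop a.unop m)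
  smul_zero _ := rfl
  smul_add _ _ _ := rfl
  add_smul a b φ := LinearMap.ext fun m =>
    (congrArg φ (add_smul a.unop b.unop m)).trans
      (map_add (show M →ₗ[Subring.center Λ] E from φ) _ _)
  zero_smul φ := LinearMap.ext fun m =>
    (congrArg φ (zero_smul Λ m)).trans (map_zero (show M →ₗ[Subring.center Λ] E from φ))

theorem smul_apply (a : Λ) (φ : CenterDual Λ E M) (m : M) :
    (MulOpposite.op a • φ) m = φ (a • m) :=
  rfl

end CenterDual

end Dual

/-! Write `D` for the dual. Over the artinian center `C`, `E` is an injective cogenerator whose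
socle contains each simple module once, so `D` does not increase length. Hence submodules of `D(A)`,
for `A` of finite length, are their own double annihilators (`mem_of_vanishing`), and every map
`D(M_j) → D(M_i)` comes from a map `M_i → M_j` (`exists_eq_map`).

Endo-artinian implies Σ-algebraically compact: the values of one unknown in the solutions of a
homogeneous system form an endo-submodule. The descending chain condition yields a finite subsystem
whose freedom in that unknown is least, so a value can be fixed without losing consistency
(`IsConsistent.exists_insert`); Zorn's lemma fixes all unknowns.

Σ-algebraically compact implies endo-noetherian dual: a strictly ascending chain `U n` of
endo-submodules gives `ψ n` in `U (n + 1)` and `x n` annihilated by `U n` with `ψ n (x n) ≠ 0`. The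
condition `ψ n ⊗ m = 0` is positive primitive in `m` (`exists_primitiveFormula`); `x n` satisfies
the earlier conditions but not the `n`-th, against `exists_mem_solutions`.

Endo-noetherian dual implies endo-artinian: taking annihilators strictly reverses inclusions of
endo-submodules. -/

/-! ### Duality with respect to a minimal injective cogenerator -/

section InjectiveCogenerator

variable {C : Type u} [CommRing C] {E : Type u} [AddCommGroup E] [Module C E]

/-- The socle of `E` contains each simple module exactly once, and `E` is injective. -/
structure IsMinimalCogenerator (C : Type u) [CommRing C] (E : Type u) [AddCommGroup E]
    [Module C E] : Prop where
  baer : Module.Baer C E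
  exists_ne_zero : ∀ m : Ideal C, m.IsMaximal → ∃ e : E, e ≠ 0 ∧ ∀ t ∈ m, t • e = 0
  exists_smul_eq : ∀ m : Ideal C, m.IsMaximal → ∀ e e' : E, e ≠ 0 → (∀ t ∈ m, t • e = 0) →
    (∀ t ∈ m, t • e' = 0) → ∃ c : C, c • e = e'

theorem Ideal.exists_smul_eq_of_smul_eq_zero {m : Ideal C} (hm : m.IsMaximal)
    {R : Type u} [CommRing R] [IsReduced R] [Algebra C R]
    (hR : Function.Surjective (algebraMap C R)) {a a' : R} (ha : a ≠ 0)
    (hma : ∀ t ∈ m, t • a = 0) (hma' : ∀ t ∈ m, t • a' = 0) : ∃ c : C, c • a = a' := by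
  obtain ⟨b, rfl⟩ := hR a
  obtain ⟨b', rfl⟩ := hR a'
  -- If `b` were in `m`, it would kill its own image `a`, so `a ^ 2 = 0`. Thus `b` is invertible
  -- modulo `m`.
  have hb : b ∉ m := fun h => ha <| by
    have h1 := hma b h
    rw [Algebra.smul_def] at h1
    exact IsReduced.eq_zero _ ⟨2, by rw [pow_two, h1]⟩
  obtain ⟨c, t, ht, hc⟩ := hm.exists_inv hb
  refine ⟨c * b', ?_⟩
  have h2 := hma' t ht
  rw [Algebra.smul_def] at h2 ⊢
  have h3 := congrArg (fun x => algebraMap C R (x * b')) hc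
  simp only [map_mul, map_add, one_mul, add_mul, h2, add_zero] at h3
  rw [← h3, map_mul]
  ring

theorem IsInjectiveEnvelope.isMinimalCogenerator [IsArtinianRing C]
    {ι : (C ⧸ Ring.jacobson C) →ₗ[C] E} (hE : IsInjectiveEnvelope ι) :
    IsMinimalCogenerator C E := by
  have hrad : (Ring.jacobson C).IsRadical := by
    rw [← Ideal.jacobson_bot, IsArtinianRing.jacobson_eq_radical]
    exact Ideal.radical_isRadical _
  have : IsReduced (C ⧸ Ring.jacobson C) :=
    (Ideal.isRadical_iff_quotient_reduced _).mp hrad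
  have : IsSemisimpleRing (C ⧸ Ring.jacobson C) := IsArtinianRing.isSemisimpleRing_of_isReduced _
  have hrange : ∀ m : Ideal C, m.IsMaximal → ∀ e : E, (∀ t ∈ m, t • e = 0) →
      e ∈ LinearMap.range ι := by
    intro m hm e he
    by_cases h0 : e = 0
    · rw [h0]; exact zero_mem _
    -- Essentiality puts a nonzero multiple `c • e` in the range; `c` is invertible modulo `m`, so
    -- `e` lies there too.
    have hne : Submodule.span C {e} ⊓ LinearMap.range ι ≠ ⊥ := fun h =>
      h0 (by simpa using hE.essential _ h)
    obtain ⟨x, hx, hx0⟩ := Submodule.exists_mem_ne_zero_of_ne_bot hne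
    obtain ⟨c, rfl⟩ := Submodule.mem_span_singleton.mp hx.1
    have hc : c ∉ m := fun h => hx0 (he c h)
    obtain ⟨d, t, ht, hd⟩ := hm.exists_inv hc
    have : e = d • c • e := by
      conv_lhs => rw [← one_smul C e, ← hd, add_smul, he t ht, add_zero, mul_smul]
    rw [this]
    exact Submodule.smul_mem _ _ hx.2
  refine ⟨Module.Baer.of_injective hE.injective_module, ?_, ?_⟩
  · intro m hm
    have hJm : Ring.jacobson C ≤ m := by
      rw [← Ideal.jacobson_bot]
      exact sInf_le ⟨bot_le, hm⟩
    -- `C / J(C)` is semisimple; a complement of the image of `m` is nonzero and killed by `m`.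
    obtain ⟨I', hI'⟩ := exists_isCompl (m.map (Ideal.Quotient.mk (Ring.jacobson C)))
    have hI0 : I' ≠ ⊥ := by
      rintro rfl
      have h1 : m.map (Ideal.Quotient.mk (Ring.jacobson C)) = ⊤ := by
        simpa using hI'.sup_eq_top
      have h2 := Ideal.comap_map_of_surjective _ (Ideal.Quotient.mk_surjective (I := Ring.jacobson C)) m
      rw [h1, Ideal.comap_top, ← RingHom.ker_eq_comap_bot, Ideal.mk_ker, sup_eq_left.mpr hJm] at h2
      exact hm.ne_top h2.symm
    obtain ⟨a, ha, ha0⟩ := Submodule.exists_mem_ne_zero_of_ne_bot hI0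
    refine ⟨ι a, fun h => ha0 (hE.injective_map (by rw [h, map_zero])), fun t ht => ?_⟩
    have : t • a = 0 := by
      have hmem : Ideal.Quotient.mk (Ring.jacobson C) t * a ∈
          m.map (Ideal.Quotient.mk (Ring.jacobson C)) ⊓ I' :=
        ⟨Ideal.mul_mem_right _ _ (Ideal.mem_map_of_mem _ ht), Ideal.mul_mem_left _ _ ha⟩
      rw [hI'.inf_eq_bot] at hmem
      rw [Algebra.smul_def]
      exact hmem
    rw [← map_smul, this, map_zero]
  · intro m hm e e' he hme hme'
    obtain ⟨a, rfl⟩ := hrange m hm e hme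
    obtain ⟨a', rfl⟩ := hrange m hm e' hme'
    have key : ∀ x : C ⧸ Ring.jacobson C, (∀ t ∈ m, t • ι x = 0) → ∀ t ∈ m, t • x = 0 :=
      fun x hx t ht => hE.injective_map (by rw [map_smul, hx t ht, map_zero])
    obtain ⟨c, hc⟩ := Ideal.exists_smul_eq_of_smul_eq_zero hm
      (R := C ⧸ Ring.jacobson C) Ideal.Quotient.mk_surjective
      (fun h => he (by rw [h, map_zero])) (key a hme) (key a' hme')
    exact ⟨c, by rw [← map_smul, hc]⟩

namespace IsMinimalCogenerator

variable (hE : IsMinimalCogenerator C E)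
include hE

theorem exists_apply_ne_zero {A : Type v} [AddCommGroup A] [Module C A] {a : A} (ha : a ≠ 0) :
    ∃ ψ : A →ₗ[C] E, ψ a ≠ 0 := by
  have hann : LinearMap.ker (LinearMap.toSpanSingleton C A a) ≠ ⊤ := by
    intro h
    have : (1 : C) ∈ LinearMap.ker (LinearMap.toSpanSingleton C A a) := h ▸ trivial
    exact ha (by simpa using this)
  -- The map `C a ≅ C / ann a → E` sending `a` to a nonzero element killed by `m ⊇ ann a` extends by
  -- injectivity.
  obtain ⟨m, hm, hle⟩ := Ideal.exists_le_maximal _ hann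
  obtain ⟨e, he, hme⟩ := hE.exists_ne_zero m hm
  let f := (LinearMap.ker (LinearMap.toSpanSingleton C A a)).liftQ
    (LinearMap.toSpanSingleton C A a) le_rfl
  have hf : Function.Injective f := by
    rw [← LinearMap.ker_eq_bot]
    exact Submodule.ker_liftQ_eq_bot _ _ _ le_rfl
  let g := (LinearMap.ker (LinearMap.toSpanSingleton C A a)).liftQ
    (LinearMap.toSpanSingleton C E e) (fun t ht => hme t (hle ht))
  obtain ⟨ψ, hψ⟩ := hE.baer.extension_property f hf g
  refine ⟨ψ, fun h => he ?_⟩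
  have h1 : ψ ((1 : C) • a) = (1 : C) • e := LinearMap.congr_fun hψ (Submodule.Quotient.mk 1)
  rw [one_smul, one_smul] at h1
  rw [← h1, h]

theorem exists_vanishing_apply_ne_zero {A : Type v} [AddCommGroup A] [Module C A]
    (B : Submodule C A) {a : A} (ha : a ∉ B) :
    ∃ ψ : A →ₗ[C] E, (∀ b ∈ B, ψ b = 0) ∧ ψ a ≠ 0 := by
  obtain ⟨ψ, hψ⟩ := hE.exists_apply_ne_zero (a := B.mkQ a)
    (by simpa [Submodule.Quotient.mk_eq_zero] using ha)
  exact ⟨ψ ∘ₗ B.mkQ, fun b hb => by simp [(Submodule.Quotient.mk_eq_zero B).mpr hb], hψ⟩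

/-- Evaluation at a generator of `A ≅ C / m` embeds the dual in the part of `E` killed by `m`, which
is generated by any of its nonzero elements. -/
theorem length_hom_le_one {A : Type v} [AddCommGroup A] [Module C A] [IsSimpleModule C A] :
    Module.length C (A →ₗ[C] E) ≤ 1 := by
  rcases subsingleton_or_nontrivial (A →ₗ[C] E) with h | h
  · rw [Module.length_eq_zero]; exact zero_le
  refine (Module.length_eq_one_iff.mpr ?_).le
  rw [isSimpleModule_iff_toSpanSingleton_surjective]
  refine ⟨h, fun ψ hψ ψ' => ?_⟩
  obtain ⟨a, ha⟩ : ∃ a, ψ a ≠ 0 := by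
    by_contra! h0
    exact hψ (LinearMap.ext h0)
  have ha0 : a ≠ 0 := fun h => ha (by rw [h, map_zero])
  have hm : Ideal.IsMaximal (LinearMap.ker (LinearMap.toSpanSingleton C A a)) :=
    IsSimpleModule.ker_toSpanSingleton_isMaximal C ha0
  have hk : ∀ φ : A →ₗ[C] E, ∀ t ∈ LinearMap.ker (LinearMap.toSpanSingleton C A a),
      t • φ a = 0 := fun φ t ht => by
    rw [← map_smul, show t • a = 0 from ht, map_zero]
  obtain ⟨c, hc⟩ := hE.exists_smul_eq _ hm (ψ a) (ψ' a) ha (hk ψ) (hk ψ')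
  refine ⟨c, LinearMap.ext fun x => ?_⟩
  obtain ⟨s, rfl⟩ := IsSimpleModule.toSpanSingleton_surjective C ha0 x
  simp [← hc]

theorem length_hom_le {A : Type v} [AddCommGroup A] [Module C A] (hA : IsFiniteLength C A) :
    Module.length C (A →ₗ[C] E) ≤ Module.length C A := by
  induction hA with
  | of_subsingleton => rw [Module.length_eq_zero]; exact zero_le
  | @of_simple_quotient A _ _ N _ _ ih =>
    have h1 : Module.length C A = Module.length C N + Module.length C (A ⧸ N) :=
      Module.length_eq_add_of_exact N.subtype N.mkQ N.injective_subtype N.mkQ_surjective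
        (LinearMap.exact_subtype_mkQ N)
    let res : (A →ₗ[C] E) →ₗ[C] (N →ₗ[C] E) := LinearMap.lcomp C E N.subtype
    have h2 : Module.length C (A →ₗ[C] E) =
        Module.length C (LinearMap.ker res) + Module.length C (LinearMap.range res) :=
      Module.length_eq_add_of_exact (LinearMap.ker res).subtype res.rangeRestrict
        (Submodule.injective_subtype _) res.surjective_rangeRestrict
        (by
          intro x
          simp [Subtype.ext_iff])
    have h3 : Module.length C (LinearMap.ker res) ≤ 1 := by
      refine le_trans ?_ (hE.length_hom_le_one (A := A ⧸ N))
      have hle : LinearMap.ker res ≤ LinearMap.range (LinearMap.lcomp C E N.mkQ) := by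
        intro ψ hψ
        refine ⟨N.liftQ ψ fun n hn => ?_, by ext; simp⟩
        exact LinearMap.congr_fun (LinearMap.mem_ker.mp hψ) ⟨n, hn⟩
      exact (Module.length_le_of_injective (Submodule.inclusion hle)
        (Submodule.inclusion_injective hle)).trans
        (Module.length_le_of_surjective _ (LinearMap.surjective_rangeRestrict _))
    rw [h1, h2, Module.length_eq_one C (A ⧸ N), add_comm]
    exact add_le_add ((Module.length_le_of_injective _ (Submodule.injective_subtype _)).trans ih) h3

theorem isFiniteLength_hom {A : Type v} [AddCommGroup A] [Module C A] (hA : IsFiniteLength C A) :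
    IsFiniteLength C (A →ₗ[C] E) := by
  rw [← Module.length_ne_top_iff] at hA ⊢
  exact ne_top_of_le_ne_top hA (hE.length_hom_le (Module.length_ne_top_iff.mp hA))

/-- A submodule of the dual of a module of finite length is its own double annihilator. -/
theorem mem_of_vanishing {A : Type v} [AddCommGroup A] [Module C A] (hA : IsFiniteLength C A)
    (V : Submodule C (A →ₗ[C] E)) (ψ : A →ₗ[C] E)
    (hψ : ∀ a, (∀ φ ∈ V, φ a = 0) → ψ a = 0) : ψ ∈ V := by
  let ev : A →ₗ[C] (V →ₗ[C] E) := (LinearMap.lcomp C E V.subtype) ∘ₗ LinearMap.applyₗ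
  have hev : ∀ a, ev a = 0 ↔ ∀ φ ∈ V, φ a = 0 := fun a => by
    constructor
    · intro h φ hφ
      exact LinearMap.congr_fun h ⟨φ, hφ⟩
    · intro h
      ext φ
      exact h φ φ.2
  -- `W` is the double annihilator of `V`: the functionals that factor through the image of `A` in
  -- the dual of `V`. Applying `length_hom_le` to that image and to `V` shows that `W` is no longer
  -- than `V`.
  let W : Submodule C (A →ₗ[C] E) := LinearMap.range (LinearMap.lcomp C E ev.rangeRestrict)
  have hmem : ∀ φ : A →ₗ[C] E, (∀ a, ev a = 0 → φ a = 0) → φ ∈ W := by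
    intro φ hφ
    refine ⟨(LinearMap.ker ev).liftQ φ (fun a ha => hφ a (LinearMap.mem_ker.mp ha)) ∘ₗ
      ev.quotKerEquivRange.symm.toLinearMap, ?_⟩
    ext a
    have : ev.quotKerEquivRange.symm (ev.rangeRestrict a) = Submodule.Quotient.mk a := by
      rw [LinearEquiv.symm_apply_eq]
      rfl
    rw [LinearMap.lcomp_apply, LinearMap.comp_apply, LinearEquiv.coe_coe, this]
    exact Submodule.liftQ_apply _ _ _
  have hVW : V ≤ W := fun φ hφ => hmem φ fun a ha => (hev a).mp ha φ hφ
  have hfl := hE.isFiniteLength_hom hA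
  have hV : IsFiniteLength C V := hfl.of_injective V.injective_subtype
  have hdV := hE.isFiniteLength_hom hV
  have hr : IsFiniteLength C (LinearMap.range ev) :=
    hdV.of_injective (LinearMap.range ev).injective_subtype
  have hlen : Module.length C W ≤ Module.length C V := by
    refine (Module.length_le_of_surjective _ (LinearMap.surjective_rangeRestrict _)).trans ?_
    refine (hE.length_hom_le hr).trans ?_
    exact (Module.length_le_of_injective _ (LinearMap.range ev).injective_subtype).trans
      (hE.length_hom_le hV)
  obtain ⟨h1, h2⟩ := isFiniteLength_iff_isNoetherian_isArtinian.mp hfl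
  have hW : V = W := by
    by_contra hne
    have hlt := Submodule.height_strictMono (lt_of_le_of_ne hVW hne)
    rw [← Module.length_submodule, ← Module.length_submodule] at hlt
    exact absurd hlen (not_le.mpr hlt)
  rw [hW]
  exact hmem ψ fun a ha => hψ a ((hev a).mp ha)

theorem bidual_surjective {A : Type v} [AddCommGroup A] [Module C A] (hA : IsFiniteLength C A)
    (θ : (A →ₗ[C] E) →ₗ[C] E) : ∃ a : A, ∀ φ : A →ₗ[C] E, θ φ = φ a := by
  have h := hE.mem_of_vanishing (hE.isFiniteLength_hom hA)
    (LinearMap.range (LinearMap.applyₗ : A →ₗ[C] (A →ₗ[C] E) →ₗ[C] E)) θ (by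
      intro φ hφ
      have : φ = 0 := LinearMap.ext fun a => hφ _ ⟨a, rfl⟩
      rw [this, map_zero])
  obtain ⟨a, ha⟩ := h
  exact ⟨a, fun φ => by rw [← ha]; rfl⟩

end IsMinimalCogenerator

end InjectiveCogenerator

/-! ### Linear systems over endo-artinian modules -/

section LinearSystems

variable {R : Type u} [Ring R] {M : Type v} [AddCommGroup M] [Module R M]

/-- The left-hand side of a linear equation, as an additive function of the unknowns. -/
noncomputable def Finsupp.lhsHom {J : Type*} (c : J →₀ R) (M : Type*) [AddCommGroup M] [Module R M] :
    (J → M) →+ M where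
  toFun x := Finsupp.linearCombination R x c
  map_zero' := by simp
  map_add' x y := by simp [Finsupp.linearCombination_apply, smul_add]

theorem Finsupp.lhsHom_apply {J : Type*} (c : J →₀ R) (x : J → M) :
    c.lhsHom M x = Finsupp.linearCombination R x c :=
  rfl

theorem Finsupp.lhsHom_map {J M' : Type*} [AddCommGroup M'] [Module R M'] (f : M →ₗ[R] M')
    (c : J →₀ R) (x : J → M) : c.lhsHom M' (fun j => f (x j)) = f (c.lhsHom M x) := by
  simp [Finsupp.lhsHom_apply, Finsupp.linearCombination_apply, map_finsuppSum]

/-- The possible values of the unknown `x j` in the solutions of the homogeneous system attached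
to a set of equations. -/
def homogeneousValues {J A : Type*} (M : Type*) [AddCommGroup M] [Module R M] (j : J)
    (F : Set ((J →₀ R) × A)) : Submodule (Module.End R M) M where
  carrier := {y | ∃ x : J → M, x j = y ∧ ∀ e ∈ F, e.1.lhsHom M x = 0}
  zero_mem' := ⟨0, rfl, fun e _ => map_zero _⟩
  add_mem' := by
    rintro _ _ ⟨x, rfl, hx⟩ ⟨x', rfl, hx'⟩
    exact ⟨x + x', rfl, fun e he => by rw [map_add, hx e he, hx' e he, add_zero]⟩
  smul_mem' := by
    rintro f _ ⟨x, rfl, hx⟩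
    exact ⟨fun i => f (x i), rfl, fun e he => by rw [Finsupp.lhsHom_map, hx e he, map_zero]⟩

theorem homogeneousValues_anti {J A : Type*} (j : J) {F F' : Set ((J →₀ R) × A)} (h : F ⊆ F') :
    homogeneousValues M j F' ≤ homogeneousValues M j F := by
  rintro _ ⟨x, rfl, hx⟩
  exact ⟨x, rfl, fun e he => hx e (h he)⟩

/-- Homogeneous systems can be solved in a direct sum one component at a time. -/
theorem exists_directSum_solution {J A K : Type*} (j : J) (F : Set ((J →₀ R) × A))
    (y : ⨁ _ : K, M) (hy : ∀ k, y k ∈ homogeneousValues M j F) :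
    ∃ z : J → ⨁ _ : K, M, z j = y ∧ ∀ e ∈ F, e.1.lhsHom (⨁ _ : K, M) z = 0 := by
  classical
  choose x hxj hx using hy
  refine ⟨∑ k ∈ DFinsupp.support y, fun i => DirectSum.lof R K (fun _ => M) k (x k i), ?_, ?_⟩
  · rw [Finset.sum_apply]
    simp only [hxj, DirectSum.lof_eq_of]
    exact DirectSum.sum_support_of y
  · intro e he
    rw [map_sum]
    exact Finset.sum_eq_zero fun k _ => by rw [Finsupp.lhsHom_map, hx k e he, map_zero]

/-- A set of linear equations is consistent if its finite subsets are solvable. -/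
def IsConsistent {J A : Type*} [AddCommGroup A] [Module R A] (T : Set ((J →₀ R) × A)) : Prop :=
  ∀ F : Finset ((J →₀ R) × A), ↑F ⊆ T → ∃ x : J → A, ∀ e ∈ F, e.1.lhsHom A x = e.2

theorem IsConsistent.sUnion {J A : Type*} [AddCommGroup A] [Module R A]
    {c : Set (Set ((J →₀ R) × A))} (hc : IsChain (· ⊆ ·) c) (hne : c.Nonempty)
    (h : ∀ T ∈ c, IsConsistent T) : IsConsistent (⋃₀ c) := by
  intro F hF
  obtain ⟨T, hT, hFT⟩ := DirectedOn.exists_mem_subset_of_finset_subset_biUnion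
    (f := id) hne hc.directedOn (by simpa [Set.sUnion_eq_biUnion] using hF)
  exact h T hT F hFT

theorem IsConsistent.exists_insert {J K : Type*} (hM : IsEndoArtinian R M)
    {T : Set ((J →₀ R) × (⨁ _ : K, M))} (hT : IsConsistent T) (j : J) :
    ∃ a, IsConsistent (insert (Finsupp.single j 1, a) T) := by
  classical
  have : IsArtinian (Module.End R M) M := hM
  obtain ⟨_, ⟨F₀, hF₀, rfl⟩, hmin⟩ := IsArtinian.set_has_minimal
    {H : Submodule (Module.End R M) M | ∃ F : Finset ((J →₀ R) × (⨁ _ : K, M)), ↑F ⊆ T ∧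
      H = homogeneousValues M j (F : Set ((J →₀ R) × (⨁ _ : K, M)))} ⟨_, ∅, by simp, rfl⟩
  obtain ⟨x₀, hx₀⟩ := hT F₀ hF₀
  refine ⟨x₀ j, fun F hF => ?_⟩
  have hF' : ↑(F.erase (Finsupp.single j 1, x₀ j)) ⊆ T := by
    rw [Finset.coe_erase]
    intro e he
    exact (hF he.1).resolve_left he.2
  have hU : ↑(F₀ ∪ F.erase (Finsupp.single j 1, x₀ j)) ⊆ T := by
    rw [Finset.coe_union]
    exact Set.union_subset hF₀ hF'
  obtain ⟨x₁, hx₁⟩ := hT _ hU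
  have hle : homogeneousValues M j
        (F₀ : Set ((J →₀ R) × (⨁ _ : K, M))) ≤ homogeneousValues M j
        (↑(F₀ ∪ F.erase (Finsupp.single j 1, x₀ j)) : Set ((J →₀ R) × (⨁ _ : K, M))) := by
    have h1 := homogeneousValues_anti (M := M) j (F := (F₀ : Set ((J →₀ R) × (⨁ _ : K, M))))
      (F' := ↑(F₀ ∪ F.erase (Finsupp.single j 1, x₀ j))) (by simp)
    by_contra hne
    exact hmin _ ⟨_, hU, rfl⟩ (lt_of_le_not_ge h1 hne)
  -- Both `x₀` and `x₁` solve `F₀`, so by minimality their difference at `j` is also a value for the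
  -- larger homogeneous system. Adding `z` moves `x₁ j` to `x₀ j`.
  obtain ⟨z, hzj, hz⟩ := exists_directSum_solution (M := M) j _ (x₀ j - x₁ j) fun k => hle
    ⟨fun i => DirectSum.component R K (fun _ => M) k ((x₀ - x₁) i), rfl, fun e he => by
      rw [Finsupp.lhsHom_map, map_sub, hx₀ e he, hx₁ e (Finset.mem_union_left _ he), sub_self,
        map_zero]⟩
  have hj : (x₁ + z) j = x₀ j := by rw [Pi.add_apply, hzj, add_sub_cancel]
  refine ⟨x₁ + z, fun e he => ?_⟩
  by_cases h : e = (Finsupp.single j 1, x₀ j)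
  · rw [h, Finsupp.lhsHom_apply, Finsupp.linearCombination_single, one_smul, hj]
  · have hmem : e ∈ F₀ ∪ F.erase (Finsupp.single j 1, x₀ j) :=
      Finset.mem_union_right _ (Finset.mem_erase.mpr ⟨h, he⟩)
    rw [map_add, hx₁ e hmem, hz e hmem, add_zero]

theorem IsEndoArtinian.isSigmaAlgebraicallyCompact (hM : IsEndoArtinian R M) :
    IsSigmaAlgebraicallyCompact R M := by
  classical
  intro K I J a m hfin
  have hrange : IsConsistent (Set.range fun i => (a i, m i)) := by
    intro F hF
    rw [← Set.image_univ] at hF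
    obtain ⟨G, -, rfl⟩ := Finset.subset_set_image_iff.mp hF
    obtain ⟨x, hx⟩ := hfin G
    refine ⟨x, fun e he => ?_⟩
    obtain ⟨i, hi, rfl⟩ := Finset.mem_image.mp he
    exact hx i hi
  obtain ⟨T, hT, hmax⟩ := zorn_subset_nonempty {T | IsConsistent T}
    (fun c hc hch hne => ⟨⋃₀ c, IsConsistent.sUnion hch hne hc,
      fun _ => Set.subset_sUnion_of_mem⟩) _ hrange
  have hdet : ∀ j, ∃ b, (Finsupp.single j 1, b) ∈ T := by
    intro j
    obtain ⟨b, hb⟩ := IsConsistent.exists_insert hM hmax.prop j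
    exact ⟨b, hmax.le_of_ge hb (Set.subset_insert _ _) (Set.mem_insert _ _)⟩
  choose x hx using hdet
  refine ⟨x, fun i => ?_⟩
  -- A common solution of the `i`-th equation and of the equations fixing its finitely many unknowns
  -- must agree with `x` on them.
  obtain ⟨y, hy⟩ := hmax.prop (insert (a i, m i)
    ((a i).support.image fun j => (Finsupp.single j 1, x j))) (by
      intro e he
      rw [Finset.coe_insert, Finset.coe_image] at he
      rcases he with rfl | ⟨j, -, rfl⟩
      exacts [hT ⟨i, rfl⟩, hx j])
  have hy1 : (a i).lhsHom _ y = m i := hy _ (Finset.mem_insert_self _ _)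
  rw [← hy1, Finsupp.lhsHom_apply, Finsupp.linearCombination_apply]
  refine Finsupp.sum_congr fun j hj => ?_
  have hy2 := hy _ (Finset.mem_insert_of_mem (Finset.mem_image_of_mem _ hj))
  rw [Finsupp.lhsHom_apply, Finsupp.linearCombination_single, one_smul] at hy2
  rw [hy2]

end LinearSystems

/-! ### Positive primitive subgroups -/

section PrimitiveFormulas

/-- The positive primitive formula `∃ y, ∀ k, coeff k • x = ∑ l, rel k l • y l`. -/
structure PrimitiveFormula (R : Type u) where
  rows : ℕ
  witnesses : ℕ
  coeff : Fin rows → R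
  rel : Fin rows → Fin witnesses → R

namespace PrimitiveFormula

variable {R : Type u} [Ring R] (π : PrimitiveFormula R)

/-- The subgroup of `M` defined by a positive primitive formula. -/
def solutions (M : Type*) [AddCommGroup M] [Module R M] : AddSubgroup M where
  carrier := {m | ∃ y : Fin π.witnesses → M, ∀ k, π.coeff k • m = ∑ l, π.rel k l • y l}
  zero_mem' := ⟨0, fun k => by simp⟩
  add_mem' := by
    rintro m m' ⟨y, hy⟩ ⟨y', hy'⟩
    exact ⟨y + y', fun k => by simp [hy, hy', smul_add, Finset.sum_add_distrib]⟩
  neg_mem' := by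
    rintro m ⟨y, hy⟩
    exact ⟨-y, fun k => by simp [hy]⟩

theorem map_mem_solutions {M M' : Type*} [AddCommGroup M] [Module R M] [AddCommGroup M']
    [Module R M'] (f : M →ₗ[R] M') {m : M} (hm : m ∈ π.solutions M) : f m ∈ π.solutions M' := by
  obtain ⟨y, hy⟩ := hm
  exact ⟨fun l => f (y l), fun k => by rw [← map_smul, hy, map_sum]; simp only [map_smul]⟩

end PrimitiveFormula

variable {R : Type u} [Ring R] {M : Type v} [AddCommGroup M] [Module R M]

/-- Finite intersections of positive primitive subgroups of a `Σ`-algebraically compact module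
satisfy the descending chain condition. -/
theorem IsSigmaAlgebraicallyCompact.exists_mem_solutions (h : IsSigmaAlgebraicallyCompact R M)
    (π : ℕ → PrimitiveFormula R) (m : ℕ → M) (hm : ∀ n, ∀ k < n, m n ∈ (π k).solutions M) :
    ∃ n, m n ∈ (π n).solutions M := by
  classical
  let K := ULift.{max u v} ℕ
  let e : ℕ → M →ₗ[R] ⨁ _ : K, M := fun n => DirectSum.lof R K (fun _ => M) ⟨n⟩
  let s : ℕ → ⨁ _ : K, M := fun n => ∑ i ∈ Finset.range (n + 1), e i (m i)
  let J := ULift.{max u v} (Option (Σ n, Fin (π n).witnesses))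
  let I := ULift.{max u v} (Σ n, Fin (π n).rows)
  let a : I → J →₀ R := fun i => Finsupp.single ⟨none⟩ ((π i.down.1).coeff i.down.2) -
    ∑ l, Finsupp.single ⟨some ⟨i.down.1, l⟩⟩ ((π i.down.1).rel i.down.2 l)
  have ha : ∀ (x : J → ⨁ _ : K, M) (i : I), ((a i).sum fun j r => r • x j) =
      (π i.down.1).coeff i.down.2 • x ⟨none⟩ -
        ∑ l, (π i.down.1).rel i.down.2 l • x ⟨some ⟨i.down.1, l⟩⟩ := fun x i => by
    rw [← Finsupp.linearCombination_apply]
    simp [a, map_sub, map_sum]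
  -- The system says that `X - s n` satisfies `π n` for all `n`; finitely many of these conditions
  -- are met by a late partial sum `s N`.
  obtain ⟨x, hx⟩ := h K I J a (fun i => (π i.down.1).coeff i.down.2 • s i.down.1) (by
    intro F
    obtain ⟨N, hN⟩ : ∃ N, ∀ i ∈ F, i.down.1 ≤ N :=
      ⟨F.sup fun i => i.down.1, fun i hi => Finset.le_sup (f := fun i : I => i.down.1) hi⟩
    have hs : ∀ n, n ≤ N → s N - s n ∈ (π n).solutions (⨁ _ : K, M) := by
      intro n hn
      have : s N - s n = ∑ i ∈ Finset.Ico (n + 1) (N + 1), e i (m i) :=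
        (Finset.sum_Ico_eq_sub _ (by omega)).symm
      rw [this]
      refine AddSubgroup.sum_mem _ fun i hi => (π n).map_mem_solutions _ (hm i n ?_)
      have := (Finset.mem_Ico.mp hi).1
      omega
    choose y hy using hs
    refine ⟨fun j => j.down.elim (s N) fun w => if hw : w.1 ≤ N then y w.1 hw w.2 else 0,
      fun i hi => ?_⟩
    rw [ha]
    have hi' := hN i hi
    simp only [Option.elim_none, Option.elim_some, dif_pos hi']
    rw [← hy _ hi', smul_sub, sub_sub_cancel])
  have hsol : ∀ n, x ⟨none⟩ - s n ∈ (π n).solutions (⨁ _ : K, M) := fun n =>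
    ⟨fun l => x ⟨some ⟨n, l⟩⟩, fun k => by
      have := hx ⟨n, k⟩
      rw [ha] at this
      rw [smul_sub, ← this, sub_sub_cancel]⟩
  -- Outside the finite support of the solution, the `n`-th component of `X - s n` is `-m n`.
  obtain ⟨⟨n⟩, hn⟩ := (DFinsupp.finite_support (x ⟨none⟩)).exists_notMem
  have hn0 : x ⟨none⟩ ⟨n⟩ = 0 := not_not.mp hn
  refine ⟨n, ?_⟩
  have h1 := (π n).map_mem_solutions (DirectSum.component R K (fun _ => M) ⟨n⟩) (hsol n)
  have h2 : DirectSum.component R K (fun _ => M) ⟨n⟩ (x ⟨none⟩ - s n) = - m n := by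
    have h3 : ∀ i, DirectSum.component R K (fun _ => M) ⟨n⟩ (e i (m i)) =
        if i = n then m n else 0 := by
      intro i
      by_cases hi : i = n
      · subst hi; simp [e, DirectSum.component.lof_self]
      · rw [if_neg hi]
        exact DirectSum.of_eq_of_ne _ _ _ fun h => hi (congrArg ULift.down h).symm
    rw [map_sub, ← DirectSum.apply_eq_component, hn0, zero_sub, map_sum]
    simp [h3]
  rw [h2] at h1
  simpa using neg_mem h1

end PrimitiveFormulas

/-! ### Finiteness over the center -/

section ArtinAlgebra

variable (k : Type r) [CommRing k] [IsArtinianRing k] (Λ : Type u) [Ring Λ] [Algebra k Λ]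
  [Module.Finite k Λ]

include k

theorem Subring.center_isArtinianRing_and_finite :
    IsArtinianRing (Subring.center Λ) ∧ Module.Finite (Subring.center Λ) Λ := by
  let f : k →+* Subring.center Λ := (algebraMap k Λ).codRestrict (Subring.center Λ) fun x =>
    Subring.mem_center_iff.mpr fun a => (Algebra.commutes x a).symm
  let _ : Algebra k (Subring.center Λ) := f.toAlgebra
  have : IsScalarTower k (Subring.center Λ) Λ :=
    ⟨fun x c a => by
      change ((f x * c : Subring.center Λ) : Λ) * a = x • ((c : Λ) * a)
      rw [Algebra.smul_def, ← mul_assoc]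
      rfl⟩
  let i : Subring.center Λ →ₗ[k] Λ :=
    { toFun := Subtype.val
      map_add' := fun _ _ => rfl
      map_smul' := fun x c => (Algebra.smul_def x (c : Λ)).symm }
  have : Module.Finite k (Subring.center Λ) := Module.Finite.of_injective i Subtype.val_injective
  exact ⟨IsArtinianRing.of_finite k _, Module.Finite.of_restrictScalars_finite k _ Λ⟩

theorem isNoetherianRing_mulOpposite_of_finite : IsNoetherianRing Λᵐᵒᵖ := by
  have : Module.Finite k Λᵐᵒᵖ := Module.Finite.equiv (MulOpposite.opLinearEquiv k)
  exact isNoetherian_of_tower k inferInstance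

end ArtinAlgebra

namespace Subring

variable {Λ : Type u} [Ring Λ] {M : Type v} [AddCommGroup M] [Module Λ M]

instance center_smulCommClass_module : SMulCommClass (Subring.center Λ) Λ M where
  smul_comm c a m := by
    change (c : Λ) • a • m = a • (c : Λ) • m
    rw [← mul_smul, ← mul_smul, Subring.mem_center_iff.mp c.2 a]

theorem isFiniteLength_center [IsArtinianRing (Subring.center Λ)]
    [Module.Finite (Subring.center Λ) Λ] [Module.Finite Λ M] :
    IsFiniteLength (Subring.center Λ) M := by
  have : Module.Finite (Subring.center Λ) M := Module.Finite.trans Λ M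
  exact isFiniteLength_iff_isNoetherian_isArtinian.mpr ⟨inferInstance, inferInstance⟩

end Subring

/-! ### Functoriality of the dual, and tensor vanishing as a formula -/

namespace CenterDual

variable {Λ : Type u} [Ring Λ] {E : Type u} [AddCommGroup E] [Module (Subring.center Λ) E]
variable {M : Type v} [AddCommGroup M] [Module Λ M] {M' : Type*} [AddCommGroup M'] [Module Λ M']

variable (Λ E M) in
/-- The dual of `M` is the group of linear maps over the center from `M` to `E`. -/
def homEquiv : CenterDual Λ E M ≃+ (M →ₗ[Subring.center Λ] E) :=
  AddEquiv.refl _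

@[simp]
theorem homEquiv_apply (φ : CenterDual Λ E M) (m : M) : homEquiv Λ E M φ m = φ m :=
  rfl

@[ext]
theorem ext {φ ψ : CenterDual Λ E M} (h : ∀ m, φ m = ψ m) : φ = ψ :=
  DFunLike.ext _ _ h

@[simp]
theorem zero_apply (m : M) : (0 : CenterDual Λ E M) m = 0 :=
  rfl

@[simp]
theorem add_apply (φ ψ : CenterDual Λ E M) (m : M) : (φ + ψ) m = φ m + ψ m :=
  rfl

theorem sum_apply {κ : Type*} (s : Finset κ) (φ : κ → CenterDual Λ E M) (m : M) :
    (∑ i ∈ s, φ i) m = ∑ i ∈ s, φ i m := by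
  rw [← homEquiv_apply, map_sum, LinearMap.sum_apply]
  rfl

theorem apply_sum {κ : Type*} (s : Finset κ) (φ : CenterDual Λ E M) (m : κ → M) :
    φ (∑ i ∈ s, m i) = ∑ i ∈ s, φ (m i) :=
  map_sum (homEquiv Λ E M φ) m s

theorem op_smul_apply (a : Λᵐᵒᵖ) (φ : CenterDual Λ E M) (m : M) : (a • φ) m = φ (a.unop • m) :=
  rfl

variable (E) in
/-- The functoriality of the dual. -/
def map (f : M →ₗ[Λ] M') : CenterDual Λ E M' →ₗ[Λᵐᵒᵖ] CenterDual Λ E M where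
  toFun φ := (homEquiv Λ E M).symm
    (homEquiv Λ E M' φ ∘ₗ f.restrictScalars (Subring.center Λ))
  map_add' _ _ := rfl
  map_smul' a φ := by
    ext m
    exact congrArg φ (map_smul f a.unop m).symm

@[simp]
theorem map_apply (f : M →ₗ[Λ] M') (φ : CenterDual Λ E M') (m : M) : map E f φ m = φ (f m) :=
  rfl

/-- Central scalars act on the dual through endomorphisms, so endo-submodules are stable under them.
-/
theorem homEquiv_symm_smul (c : Subring.center Λ) (φ : M →ₗ[Subring.center Λ] E) :
    (homEquiv Λ E M).symm (c • φ) =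
      map E (DistribSMul.toLinearMap Λ M c) ((homEquiv Λ E M).symm φ) := by
  ext m
  exact (map_smul φ c m).symm

theorem homEquiv_symm_smul_eq_op_smul (c : Subring.center Λ) (φ : M →ₗ[Subring.center Λ] E) :
    (homEquiv Λ E M).symm (c • φ) =
      MulOpposite.op (c : Λ) • (homEquiv Λ E M).symm φ := by
  ext m
  exact (map_smul φ c m).symm

theorem exists_eq_map (hE : IsMinimalCogenerator (Subring.center Λ) E)
    (hM' : IsFiniteLength (Subring.center Λ) M')
    (g : CenterDual Λ E M' →ₗ[Λᵐᵒᵖ] CenterDual Λ E M) : ∃ f : M →ₗ[Λ] M', g = map E f := by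
  have h : ∀ m : M, ∃ m' : M', ∀ φ : CenterDual Λ E M', g φ m = φ m' := by
    intro m
    exact hE.bidual_surjective hM'
      { toFun := fun φ => g ((homEquiv Λ E M').symm φ) m
        map_add' := fun φ ψ => by rw [map_add, map_add, add_apply]
        map_smul' := fun c φ => by
          rw [homEquiv_symm_smul_eq_op_smul, map_smul]
          exact map_smul (homEquiv Λ E M (g ((homEquiv Λ E M').symm φ))) c m }
  choose f hf using h
  have key : ∀ x y : M', (∀ φ : CenterDual Λ E M', φ x = φ y) → x = y := by
    intro x y hxy
    by_contra hne
    obtain ⟨ψ, hψ⟩ := hE.exists_apply_ne_zero (sub_ne_zero.mpr hne)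
    exact hψ (by rw [map_sub, sub_eq_zero]; exact hxy ψ)
  refine ⟨⟨⟨f, fun x y => key _ _ fun φ => ?_⟩, fun a x => key _ _ fun φ => ?_⟩, ?_⟩
  · rw [← hf]
    exact (map_add (homEquiv Λ E M (g φ)) x y).trans
      ((congrArg₂ _ (hf x φ) (hf y φ)).trans (map_add (homEquiv Λ E M' φ) _ _).symm)
  · rw [← hf, ← smul_apply, ← map_smul, hf]
    rfl
  · ext φ m
    exact hf m φ

theorem finite (hE : IsMinimalCogenerator (Subring.center Λ) E)
    (hM : IsFiniteLength (Subring.center Λ) M) : Module.Finite Λᵐᵒᵖ (CenterDual Λ E M) := by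
  have hn := (isFiniteLength_iff_isNoetherian_isArtinian.mp (hE.isFiniteLength_hom hM)).1
  obtain ⟨s, hs⟩ := hn.noetherian ⊤
  classical
  refine ⟨⟨s.image (homEquiv Λ E M).symm, ?_⟩⟩
  rw [eq_top_iff]
  intro φ _
  have hφ : homEquiv Λ E M φ ∈ Submodule.span (Subring.center Λ)
    (s : Set (M →ₗ[Subring.center Λ] E)) := hs ▸ Submodule.mem_top
  rw [← (homEquiv Λ E M).symm_apply_apply φ]
  generalize homEquiv Λ E M φ = ψ at hφ ⊢
  induction hφ using Submodule.span_induction with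
  | mem x hx => exact Submodule.subset_span (Finset.mem_coe.mpr (Finset.mem_image_of_mem _ hx))
  | zero => rw [map_zero]; exact zero_mem _
  | add x y _ _ hx hy => rw [map_add]; exact add_mem hx hy
  | smul c x _ hx => rw [homEquiv_symm_smul_eq_op_smul]; exact Submodule.smul_mem _ _ hx

/-- The condition that `φ : X` is killed by pairing with `m` under all homomorphisms from `X` to
the dual of a module containing `m` (equivalently, `φ ⊗ m = 0`) is a positive primitive formula. -/
theorem exists_primitiveFormula (hE : IsMinimalCogenerator (Subring.center Λ) E)
    [IsNoetherianRing Λᵐᵒᵖ] {X : Type*} [AddCommGroup X] [Module Λᵐᵒᵖ X] [Module.Finite Λᵐᵒᵖ X]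
    (φ : X) : ∃ π : PrimitiveFormula Λ, ∀ m : M,
      m ∈ π.solutions M ↔ ∀ g : X →ₗ[Λᵐᵒᵖ] CenterDual Λ E M, g φ m = 0 := by
  classical
  obtain ⟨p, f, hf⟩ := Module.Finite.exists_fin' Λᵐᵒᵖ X
  obtain ⟨q, s, hs⟩ := Submodule.fg_iff_exists_fin_generating_family.mp
    (IsNoetherian.noetherian (LinearMap.ker f))
  obtain ⟨α, rfl⟩ := hf φ
  have happ : ∀ (h : (Fin p → Λᵐᵒᵖ) →ₗ[Λᵐᵒᵖ] CenterDual Λ E M) (β : Fin p → Λᵐᵒᵖ) (m : M),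
      h β m = ∑ i, h (Pi.single i 1) ((β i).unop • m) := by
    intro h β m
    conv_lhs => rw [pi_eq_sum_univ' β, map_sum]
    rw [sum_apply]
    refine Finset.sum_congr rfl fun i _ => ?_
    rw [map_smul, op_smul_apply]
  -- With `X` presented by generators and relations `s l`, and `φ` the image of `α`, `φ ⊗ m = 0`
  -- means that the tuple `α i • m` is a combination of the relations with coefficients in `M`.
  refine ⟨⟨p, q, fun i => (α i).unop, fun i l => (s l i).unop⟩, fun m => ⟨?_, fun h => ?_⟩⟩
  · rintro ⟨y, hy⟩ g
    dsimp only at hy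
    rw [← LinearMap.comp_apply, happ]
    simp only [hy, apply_sum]
    rw [Finset.sum_comm]
    refine Finset.sum_eq_zero fun l _ => ?_
    rw [← happ (g ∘ₗ f) (s l) (y l), LinearMap.comp_apply]
    have : f (s l) = 0 := by
      rw [← LinearMap.mem_ker, ← hs]
      exact Submodule.subset_span ⟨l, rfl⟩
    rw [this, map_zero, zero_apply]
  · by_contra hm
    let W : (Fin q → M) →ₗ[Subring.center Λ] (Fin p → M) :=
      LinearMap.pi fun i => ∑ l, leftMul Λ M (s l i).unop ∘ₗ LinearMap.proj l
    have hW : ∀ y i, W y i = ∑ l, (s l i).unop • y l := fun y i => by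
      simp only [W, LinearMap.pi_apply, LinearMap.sum_apply]
      rfl
    have hmW : (fun i => (α i).unop • m) ∉ LinearMap.range W := by
      rintro ⟨y, hy⟩
      exact hm ⟨y, fun i => by rw [← hW, hy]⟩
    -- A functional separating the tuple from these combinations kills the relations, so it descends
    -- to a map on `X` that is nonzero on `φ` at `m`.
    obtain ⟨ψ, hψW, hψm⟩ := hE.exists_vanishing_apply_ne_zero _ hmW
    let ψ' : Fin p → CenterDual Λ E M := fun i =>
      (homEquiv Λ E M).symm (ψ ∘ₗ LinearMap.single (Subring.center Λ) (fun _ => M) i)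
    have hψ' : ∀ v : Fin p → M, ψ v = ∑ i, ψ' i (v i) := fun v => by
      conv_lhs => rw [← Finset.univ_sum_single v, map_sum]
      rfl
    let h' : (Fin p → Λᵐᵒᵖ) →ₗ[Λᵐᵒᵖ] CenterDual Λ E M := Fintype.linearCombination Λᵐᵒᵖ ψ'
    have hh' : ∀ β m, h' β m = ψ fun i => (β i).unop • m := by
      intro β m
      rw [hψ', Fintype.linearCombination_apply, sum_apply]
      rfl
    have hker : LinearMap.ker f ≤ LinearMap.ker h' := by
      rw [← hs, Submodule.span_le]
      rintro _ ⟨l, rfl⟩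
      rw [SetLike.mem_coe, LinearMap.mem_ker]
      ext y
      rw [hh', zero_apply]
      apply hψW
      refine ⟨Pi.single l y, funext fun i => ?_⟩
      rw [hW, Finset.sum_eq_single l]
      · rw [Pi.single_eq_same]
      · intro l' _ hl
        rw [Pi.single_eq_of_ne hl, smul_zero]
      · simp
    have hg := h ((LinearMap.ker f).liftQ h' hker ∘ₗ
      (f.quotKerEquivOfSurjective hf).symm.toLinearMap)
    have hα : (f.quotKerEquivOfSurjective hf).symm (f α) = Submodule.Quotient.mk α := by
      rw [LinearEquiv.symm_apply_eq]
      rfl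
    rw [LinearMap.comp_apply, LinearEquiv.coe_coe, hα, Submodule.liftQ_apply, hh'] at hg
    exact hψm hg

end CenterDual

/-! ### Endo-submodules of direct sums and their annihilators -/

section DirectSumsOfModules

variable {Λ : Type u} [Ring Λ] {E : Type u} [AddCommGroup E] [Module (Subring.center Λ) E]
  {I : Type w₁} [DecidableEq I] {M : I → Type v} [∀ i, AddCommGroup (M i)] [∀ i, Module Λ (M i)]

namespace DirectSum

theorem apply_mem_of_lof_mem {R : Type*} [Ring R] {ι : Type*} [DecidableEq ι] {N : ι → Type*}
    [∀ i, AddCommGroup (N i)] [∀ i, Module R (N i)]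
    (U : Submodule (Module.End R (⨁ i, N i)) (⨁ i, N i)) {i j : ι} (f : N i →ₗ[R] N j) {x : N i}
    (hx : lof R ι N i x ∈ U) : lof R ι N j (f x) ∈ U := by
  have h := U.smul_mem (lof R ι N j ∘ₗ f ∘ₗ component R ι N i : Module.End R (⨁ i, N i)) hx
  rwa [Module.End.smul_def, LinearMap.comp_apply, LinearMap.comp_apply, component.lof_self] at h

/-- Endo-submodules are stable under the projections to the summands, hence determined by their
homogeneous elements. -/
theorem exists_lof_notMem {R : Type*} [Ring R] {ι : Type*} [DecidableEq ι] {N : ι → Type*}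
    [∀ i, AddCommGroup (N i)] [∀ i, Module R (N i)]
    {U U' : Submodule (Module.End R (⨁ i, N i)) (⨁ i, N i)} (h : ¬ U ≤ U') :
    ∃ i, ∃ x : N i, lof R ι N i x ∈ U ∧ lof R ι N i x ∉ U' := by
  classical
  obtain ⟨u, hu, hu'⟩ := Set.not_subset.mp h
  by_contra! h0
  refine hu' ?_
  rw [← sum_support_of u]
  exact sum_mem fun i _ => h0 i (u i)
    (U.smul_mem (lof R ι N i ∘ₗ component R ι N i : Module.End R (⨁ i, N i)) hu)

end DirectSum

open DirectSum

variable (E) in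
/-- The annihilator, in the direct sum of the duals, of an endo-submodule of a direct sum. -/
def endoAnnihilator (hE : IsMinimalCogenerator (Subring.center Λ) E)
    (hM : ∀ i, IsFiniteLength (Subring.center Λ) (M i))
    (U : Submodule (Module.End Λ (⨁ i, M i)) (⨁ i, M i)) :
    Submodule (Module.End Λᵐᵒᵖ (⨁ i, CenterDual Λ E (M i))) (⨁ i, CenterDual Λ E (M i)) where
  carrier := {φ | ∀ i, ∀ x : M i, lof Λ I M i x ∈ U → φ i x = 0}
  zero_mem' i x _ := rfl
  add_mem' := by
    intro φ ψ hφ hψ i x hx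
    rw [DirectSum.add_apply, CenterDual.add_apply, hφ i x hx, hψ i x hx, add_zero]
  smul_mem' := by
    classical
    intro g φ hφ i x hx
    have hsum : φ = ∑ j ∈ DFinsupp.support φ,
        lof Λᵐᵒᵖ I (fun i => CenterDual Λ E (M i)) j (φ j) := (sum_support_of φ).symm
    rw [Module.End.smul_def, hsum, map_sum, apply_eq_component Λᵐᵒᵖ, map_sum,
      CenterDual.sum_apply]
    refine Finset.sum_eq_zero fun j _ => ?_
    -- Each matrix entry of `g` is dual to some `f : M i → M j`, under which `U` is stable.
    obtain ⟨f, hf⟩ := CenterDual.exists_eq_map hE (hM j)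
      (component Λᵐᵒᵖ I (fun i => CenterDual Λ E (M i)) i ∘ₗ g ∘ₗ
        lof Λᵐᵒᵖ I (fun i => CenterDual Λ E (M i)) j)
    have h := congrArg (fun χ : CenterDual Λ E (M i) => χ x) (LinearMap.congr_fun hf (φ j))
    refine h.trans ?_
    exact hφ j (f x) (apply_mem_of_lof_mem U f hx)

theorem endoAnnihilator_strictAnti (hE : IsMinimalCogenerator (Subring.center Λ) E)
    (hM : ∀ i, IsFiniteLength (Subring.center Λ) (M i)) :
    StrictAnti (endoAnnihilator E hE hM) := by
  intro U' U hlt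
  refine lt_of_le_not_ge (fun φ hφ i x hx => hφ i x (hlt.le hx)) fun hle => ?_
  obtain ⟨i, x, hx, hx'⟩ := exists_lof_notMem hlt.not_ge
  let B : Submodule (Subring.center Λ) (M i) :=
    { carrier := {y | lof Λ I M i y ∈ U'}
      zero_mem' := by simp
      add_mem' := fun {y z} hy hz => by
        change lof Λ I M i (y + z) ∈ U'
        rw [map_add]
        exact add_mem hy hz
      smul_mem' := fun c y hy =>
        apply_mem_of_lof_mem U' (DistribSMul.toLinearMap Λ (M i) c) hy }
  obtain ⟨ψ, hψB, hψ⟩ := hE.exists_vanishing_apply_ne_zero B (a := x) hx'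
  let χ := (CenterDual.homEquiv Λ E (M i)).symm ψ
  have hχ : lof Λᵐᵒᵖ I (fun i => CenterDual Λ E (M i)) i χ ∈ endoAnnihilator E hE hM U' := by
    intro j y hy
    by_cases hij : i = j
    · subst hij
      rw [lof_apply]
      exact hψB y hy
    · rw [lof_eq_of, of_eq_of_ne _ _ _ (Ne.symm hij), CenterDual.zero_apply]
  have h := hle hχ i x hx
  rw [lof_apply] at h
  exact hψ h

theorem IsEndoNoetherian.isEndoArtinian (hE : IsMinimalCogenerator (Subring.center Λ) E)
    (hM : ∀ i, IsFiniteLength (Subring.center Λ) (M i))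
    (h : IsEndoNoetherian Λᵐᵒᵖ (⨁ i, CenterDual Λ E (M i))) : IsEndoArtinian Λ (⨁ i, M i) := by
  have := isNoetherian_iff'.mp h
  exact (endoAnnihilator_strictAnti hE hM).wellFoundedLT

theorem exists_apply_ne_zero_of_lof_notMem (hE : IsMinimalCogenerator (Subring.center Λ) E)
    (hM : ∀ i, IsFiniteLength (Subring.center Λ) (M i))
    (U : Submodule (Module.End Λᵐᵒᵖ (⨁ i, CenterDual Λ E (M i))) (⨁ i, CenterDual Λ E (M i)))
    {i : I} {ψ : CenterDual Λ E (M i)}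
    (hψ : lof Λᵐᵒᵖ I (fun i => CenterDual Λ E (M i)) i ψ ∉ U) :
    ∃ x : M i, (∀ χ, lof Λᵐᵒᵖ I (fun i => CenterDual Λ E (M i)) i χ ∈ U → χ x = 0) ∧
      ψ x ≠ 0 := by
  let V : Submodule (Subring.center Λ) (M i →ₗ[Subring.center Λ] E) :=
    { carrier := {χ | lof Λᵐᵒᵖ I (fun i => CenterDual Λ E (M i)) i
        ((CenterDual.homEquiv Λ E (M i)).symm χ) ∈ U}
      zero_mem' := by simp
      add_mem' := fun {y z} hy hz => by
        change lof Λᵐᵒᵖ I (fun i => CenterDual Λ E (M i)) i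
          ((CenterDual.homEquiv Λ E (M i)).symm (y + z)) ∈ U
        rw [map_add, map_add]
        exact add_mem hy hz
      smul_mem' := fun c y hy => by
        change lof Λᵐᵒᵖ I (fun i => CenterDual Λ E (M i)) i
          ((CenterDual.homEquiv Λ E (M i)).symm (c • y)) ∈ U
        rw [CenterDual.homEquiv_symm_smul]
        exact apply_mem_of_lof_mem U _ hy }
  by_contra! h
  exact hψ (hE.mem_of_vanishing (hM i) V (CenterDual.homEquiv Λ E (M i) ψ) fun x hx =>
    h x fun χ hχ => hx (CenterDual.homEquiv Λ E (M i) χ) hχ)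

theorem IsSigmaAlgebraicallyCompact.isEndoNoetherian_dual [IsNoetherianRing Λᵐᵒᵖ]
    (hE : IsMinimalCogenerator (Subring.center Λ) E)
    (hM : ∀ i, IsFiniteLength (Subring.center Λ) (M i))
    (h : IsSigmaAlgebraicallyCompact Λ (⨁ i, M i)) :
    IsEndoNoetherian Λᵐᵒᵖ (⨁ i, CenterDual Λ E (M i)) := by
  rw [IsEndoNoetherian, isNoetherian_iff', WellFoundedGT, isWellFounded_iff,
    RelEmbedding.wellFounded_iff_isEmpty]
  refine ⟨fun U => ?_⟩
  have hU : StrictMono U := fun a b hab => U.map_rel_iff.mpr hab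
  choose j ψ hψ hψ' using fun n : ℕ => exists_lof_notMem (hU n.lt_succ_self).not_ge
  choose x hx hx' using fun n => exists_apply_ne_zero_of_lof_notMem hE hM (U n) (hψ' n)
  have hfin : ∀ i, Module.Finite Λᵐᵒᵖ (CenterDual Λ E (M i)) := fun i =>
    CenterDual.finite hE (hM i)
  choose π hπ using fun n => CenterDual.exists_primitiveFormula (M := ⨁ i, M i) hE (ψ n)
  obtain ⟨n, hn⟩ := h.exists_mem_solutions π (fun n => lof Λ I M (j n) (x n)) (by
    intro n k hk
    rw [hπ]
    intro g
    refine hx n (CenterDual.map E (lof Λ I M (j n)) (g (ψ k))) ?_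
    exact apply_mem_of_lof_mem (U n) (CenterDual.map E (lof Λ I M (j n)) ∘ₗ g)
      (hU.monotone (Nat.succ_le_of_lt hk) (hψ k)))
  rw [hπ] at hn
  -- The dual of the projection onto the `j n`-th summand recovers the pairing `ψ n (x n)`, which is
  -- nonzero.
  have := hn (CenterDual.map E (component Λ I M (j n)))
  rw [CenterDual.map_apply, component.lof_self] at this
  exact hx' n this

end DirectSumsOfModules
theorem propositionL
    -- `Λ` is an Artin algebra: a module-finite algebra over a commutative artinian ring `k`
    (k : Type r) [CommRing k] [IsArtinianRing k]
    (Λ : Type u₁) [Ring Λ] [Algebra k Λ] [Module.Finite k Λ]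
    -- `E` is the injective envelope of `C / J(C)` over the center `C` of `Λ`
    (E : Type u₁) [AddCommGroup E] [Module (Subring.center Λ) E]
    (ι : (Subring.center Λ ⧸ Ring.jacobson (Subring.center Λ)) →ₗ[Subring.center Λ] E)
    (hE : IsInjectiveEnvelope ι)
    -- `M` is a family of finitely generated left `Λ`-modules
    (I : Type w₁) (M : I → Type v₁) [∀ i, AddCommGroup (M i)] [∀ i, Module Λ (M i)]
    [∀ i, Module.Finite Λ (M i)] :
    List.TFAE
      [IsSigmaAlgebraicallyCompact Λ (⨁ i, M i),
        IsEndoArtinian Λ (⨁ i, M i),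
        IsEndoNoetherian Λᵐᵒᵖ (⨁ i, CenterDual Λ E (M i))] := by
  classical
  obtain ⟨hC, hCΛ⟩ := Subring.center_isArtinianRing_and_finite k Λ
  have := isNoetherianRing_mulOpposite_of_finite k Λ
  have hE' := hE.isMinimalCogenerator
  have hM : ∀ i, IsFiniteLength (Subring.center Λ) (M i) := fun i => Subring.isFiniteLength_center
  tfae_have 2 → 1 := IsEndoArtinian.isSigmaAlgebraicallyCompact
  tfae_have 1 → 3 := fun h => h.isEndoNoetherian_dual hE' hM
  tfae_have 3 → 2 := fun h => h.isEndoArtinian hE' hM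
  tfae_finish
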